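/- Let $\alpha>0$, $m=[\alpha]$ (integer part), $n=m+1$ and $1\le p<\infty$. For $\varphi\in C_0^\infty(\mathbb R)$ (smooth, compactly supported, real valued) let $${}^{-}D^{\alpha}\varphi=\frac{d^n}{dx^n}\,\frac1{\Gamma(n-\alpha)}\int_{-\infty}^x (x-y)^{n-\alpha-1}\varphi(y)\,dy,\qquad {}^{+}D^{\alpha}\varphi=(-1)^n\frac{d^n}{dx^n}\,\frac1{\Gamma(n-\alpha)}\int_x^{\infty} (y-x)^{n-\alpha-1}\varphi(y)\,dy$$ be the left and right Riemann–Liouville derivatives. A function $v\in L^1_{loc}(\mathbb R)$ is the left (resp. right) weak fractional derivative ${}^{\pm}\mathcal D^\alpha u$ (with $-$ for left, $+$ for right) of a function $u\in L^p(\mathbb R)$ if $\int_{\mathbb R} v\varphi\,dx=(-1)^{[\alpha]}\int_{\mathbb R}u\;{}^{\mp}D^\alpha\varphi\,dx$ for all $\varphi\in C_0^\infty(\mathbb R)$. Put $${}^{\pm}W^{\alpha,p}(\mathbb R)=\{u\in W^{m,p}(\mathbb R):\ {}^{\pm}\mathcal D^\alpha u\in L^p(\mathbb R)\},\qquad \|u\|_{{}^{\pm}W^{\alpha,p}}=\bigl(\|u\|_{W^{m,p}}^p+\|{}^{\pm}\mathcal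 D^\alpha u\|_{L^p}^p\bigr)^{1/p},$$ where $\|u\|_{W^{m,p}}^p=\sum_{k=0}^m\|D^ku\|_{L^p}^p$. Let ${}^{-}C_0^\infty(\mathbb R)$ (resp. ${}^{+}C_0^\infty(\mathbb R)$) be the set of $\varphi\in C^\infty(\mathbb R)$ for which there is $c\in\mathbb R$ with $\varphi(x)=0$ for all $x>c$ (resp. for all $x<c$). **Theorem.** Let $\alpha>0$ and $1\le p<\infty$. For each of the two signs, $C_0^\infty(\mathbb R)$ is contained in ${}^{\pm}W^{\alpha,p}(\mathbb R)$ and dense in it. Hence the completion ${}^{\pm}\overline W^{\alpha,p}(\mathbb R)$ of the functions in $C^\infty(\mathbb R)$ of finite ${}^{\pm}W^{\alpha,p}$ norm, and the completion ${}^{\pm}\overline W^{\alpha,p}_0(\mathbb R)$ of the functions in ${}^{\pm}C^\infty_0(\mathbb R)$ of finite ${}^{\pm}W^{\alpha,p}$ norm, both with respect to that norm, are both equal to ${}^{\pm}W^{\alpha,p}(\mathbb R)$; that is, the inclusion of each of these function spaces extends to a linear isometric isomorphism of its completion onto ${}^{\pm}W^{\alpha,p}(\mathbb R)$. -/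

import Mathlib

open MeasureTheory Set
open scoped NNReal ENNReal ContDiff

noncomputable section

/-- The direction of a one-sided operator: `left` is the superscript `-`, `right` is `+`. -/
inductive Side where
  | left
  | right

/-- The opposite direction. -/
def Side.opp : Side → Side
  | Side.left => Side.right
  | Side.right => Side.left

/-- `φ ∈ C_0^∞(ℝ)`: smooth with compact support. -/
def IsTestFunction (φ : ℝ → ℝ) : Prop :=
  ContDiff ℝ ∞ φ ∧ HasCompactSupport φ

/-- The fractional integral of order `σ > 0` on the whole line:
`1/Γ(σ) ∫_{-∞}^x (x - y)^{σ-1} f(y) dy` (left) and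
`1/Γ(σ) ∫_x^∞ (y - x)^{σ-1} f(y) dy` (right). -/
def fracIntegral (s : Side) (σ : ℝ) (f : ℝ → ℝ) (x : ℝ) : ℝ :=
  match s with
  | Side.left => (Real.Gamma σ)⁻¹ * ∫ y in Iio x, (x - y) ^ (σ - 1) * f y
  | Side.right => (Real.Gamma σ)⁻¹ * ∫ y in Ioi x, (y - x) ^ (σ - 1) * f y

/-- The classical Riemann-Liouville derivative of order `α > 0` on the whole line; with
`n = [α] + 1` it is `(d/dx)^n I^{n-α} f` (left) and `(-1)^n (d/dx)^n I^{n-α} f` (right). -/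
def rlDeriv (s : Side) (α : ℝ) (f : ℝ → ℝ) (x : ℝ) : ℝ :=
  match s with
  | Side.left =>
      iteratedDeriv (⌊α⌋₊ + 1) (fracIntegral Side.left ((⌊α⌋₊ + 1 : ℕ) - α) f) x
  | Side.right =>
      (-1) ^ (⌊α⌋₊ + 1) *
        iteratedDeriv (⌊α⌋₊ + 1) (fracIntegral Side.right ((⌊α⌋₊ + 1 : ℕ) - α) f) x

/-- `v ∈ L^1_loc` satisfies `∫ v φ = c ∫ u (T φ)` for all test functions `φ`, where all the
integrals on the right converge absolutely. -/
def HasWeakDual (T : (ℝ → ℝ) → ℝ → ℝ) (c : ℝ) (u v : ℝ → ℝ) : Prop :=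
  LocallyIntegrable v volume ∧ ∀ φ : ℝ → ℝ, IsTestFunction φ →
    Integrable (fun x => u x * T φ x) volume ∧
      ∫ x, v x * φ x = c * ∫ x, u x * T φ x

/-- `v` is the (integer order) weak derivative `D^k u`:
`∫ v φ = (-1)^k ∫ u φ^{(k)}` for all test functions `φ`. -/
def HasWeakDeriv (k : ℕ) (u v : ℝ → ℝ) : Prop :=
  HasWeakDual (iteratedDeriv k) ((-1) ^ k) u v

/-- `v` is the left/right weak fractional derivative of order `α` of `u`:
`∫ v φ = (-1)^{[α]} ∫ u D^α φ` for all test functions `φ`, where `D^α φ` is the classical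
derivative in the opposite direction. -/
def HasWeakFracDeriv (s : Side) (α : ℝ) (u v : ℝ → ℝ) : Prop :=
  HasWeakDual (rlDeriv s.opp α) ((-1) ^ ⌊α⌋₊) u v

theorem HasWeakDual.congr {T : (ℝ → ℝ) → ℝ → ℝ} {c : ℝ} {u u' v v' : ℝ → ℝ}
    (h : HasWeakDual T c u v) (hu : u' =ᵐ[volume] u) (hv : v' =ᵐ[volume] v) :
    HasWeakDual T c u' v' := by
  refine ⟨h.1.congr hv.symm, fun φ hφ => ?_⟩
  have e1 : (fun x => u' x * T φ x) =ᵐ[volume] fun x => u x * T φ x := by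
    filter_upwards [hu] with x hx using by rw [hx]
  have e2 : (fun x => v' x * φ x) =ᵐ[volume] fun x => v x * φ x := by
    filter_upwards [hv] with x hx using by rw [hx]
  rw [integral_congr_ae e1, integral_congr_ae e2]
  exact ⟨(h.2 φ hφ).1.congr e1.symm, (h.2 φ hφ).2⟩

theorem IsTestFunction.integrable_mul {v φ : ℝ → ℝ} (hφ : IsTestFunction φ)
    (hv : LocallyIntegrable v volume) : Integrable (fun x => v x * φ x) volume := by
  have := hv.integrable_smul_right_of_hasCompactSupport hφ.1.continuous hφ.2
  simpa [smul_eq_mul] using this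

theorem HasWeakDual.add {T : (ℝ → ℝ) → ℝ → ℝ} {c : ℝ} {u u' v v' : ℝ → ℝ}
    (h : HasWeakDual T c u v) (h' : HasWeakDual T c u' v') :
    HasWeakDual T c (u + u') (v + v') := by
  refine ⟨h.1.add h'.1, fun φ hφ => ?_⟩
  obtain ⟨i1, e1⟩ := h.2 φ hφ
  obtain ⟨i2, e2⟩ := h'.2 φ hφ
  simp only [Pi.add_apply, add_mul]
  refine ⟨i1.add i2, ?_⟩
  rw [integral_add i1 i2, integral_add (hφ.integrable_mul h.1) (hφ.integrable_mul h'.1), e1, e2]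
  ring

theorem HasWeakDual.smul {T : (ℝ → ℝ) → ℝ → ℝ} {c : ℝ} {u v : ℝ → ℝ} (a : ℝ)
    (h : HasWeakDual T c u v) : HasWeakDual T c (a • u) (a • v) := by
  refine ⟨h.1.smul a, fun φ hφ => ?_⟩
  obtain ⟨i1, e1⟩ := h.2 φ hφ
  simp only [Pi.smul_apply, smul_eq_mul, mul_assoc]
  refine ⟨i1.const_mul a, ?_⟩
  rw [integral_const_mul, integral_const_mul, e1]
  ring

theorem HasWeakDual.zero (T : (ℝ → ℝ) → ℝ → ℝ) (c : ℝ) : HasWeakDual T c 0 0 := by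
  refine ⟨(locallyIntegrable_zero : LocallyIntegrable (fun _ : ℝ => (0 : ℝ)) volume),
    fun φ _ => ?_⟩
  simp

theorem HasWeakDual.unique {T : (ℝ → ℝ) → ℝ → ℝ} {c : ℝ} {u v w : ℝ → ℝ}
    (h : HasWeakDual T c u v) (h' : HasWeakDual T c u w) : v =ᵐ[volume] w := by
  refine ae_eq_of_integral_contDiff_smul_eq h.1 h'.1 fun φ hφ hc => ?_
  have := (h.2 φ ⟨hφ, hc⟩).2.trans (h'.2 φ ⟨hφ, hc⟩).2.symm
  simpa [smul_eq_mul, mul_comm] using this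

section Spaces

/-- The set of all `u ∈ W^{m,p}(ℝ)`, `m = [α]`, whose weak fractional derivative of order `α`
exists and lies in `L^p(ℝ)`, as a subspace of `L^p(ℝ)`. -/
def fracSobolevSubmodule (s : Side) (α : ℝ) (p : ℝ≥0) :
    Submodule ℝ (Lp ℝ (p : ℝ≥0∞) (volume : Measure ℝ)) where
  carrier := {u |
    (∀ k : Fin (⌊α⌋₊ + 1), ∃ v : Lp ℝ (p : ℝ≥0∞) (volume : Measure ℝ), HasWeakDeriv k u v) ∧
      ∃ v : Lp ℝ (p : ℝ≥0∞) (volume : Measure ℝ), HasWeakFracDeriv s α u v}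
  add_mem' := by
    rintro a b ⟨ha, va, hva⟩ ⟨hb, vb, hvb⟩
    refine ⟨fun k => ?_, va + vb,
      (hva.add hvb).congr (Lp.coeFn_add _ _) (Lp.coeFn_add _ _)⟩
    obtain ⟨v, hv⟩ := ha k
    obtain ⟨w, hw⟩ := hb k
    exact ⟨v + w, (HasWeakDual.add hv hw).congr (Lp.coeFn_add _ _) (Lp.coeFn_add _ _)⟩
  zero_mem' :=
    ⟨fun _ => ⟨0, (HasWeakDual.zero _ _).congr (Lp.coeFn_zero _ _ _) (Lp.coeFn_zero _ _ _)⟩,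
      0, (HasWeakDual.zero _ _).congr (Lp.coeFn_zero _ _ _) (Lp.coeFn_zero _ _ _)⟩
  smul_mem' := by
    rintro c a ⟨ha, va, hva⟩
    refine ⟨fun k => ?_, c • va, (hva.smul c).congr (Lp.coeFn_smul _ _) (Lp.coeFn_smul _ _)⟩
    obtain ⟨v, hv⟩ := ha k
    exact ⟨c • v, (HasWeakDual.smul c hv).congr (Lp.coeFn_smul _ _) (Lp.coeFn_smul _ _)⟩

/-- The one-sided fractional Sobolev space `^±W^{α,p}(ℝ)`, `p < ∞`. It is a type of its own, so
that it carries its own norm and not that of `L^p(ℝ)`. -/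
def FracSobolev (s : Side) (α : ℝ) (p : ℝ≥0) : Type :=
  fracSobolevSubmodule s α p

namespace FracSobolev

instance (s : Side) (α : ℝ) (p : ℝ≥0) : AddCommGroup (FracSobolev s α p) :=
  inferInstanceAs (AddCommGroup (fracSobolevSubmodule s α p))

instance (s : Side) (α : ℝ) (p : ℝ≥0) : Module ℝ (FracSobolev s α p) :=
  inferInstanceAs (Module ℝ (fracSobolevSubmodule s α p))

variable {s : Side} {α : ℝ} {p : ℝ≥0}

/-- The underlying element of `L^p(ℝ)`. -/
def toLp : FracSobolev s α p →ₗ[ℝ] Lp ℝ (p : ℝ≥0∞) (volume : Measure ℝ) :=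
  (fracSobolevSubmodule s α p).subtype

/-- `f` is a representative of `u`. -/
def Represents (f : ℝ → ℝ) (u : FracSobolev s α p) : Prop :=
  (toLp u : ℝ → ℝ) =ᵐ[volume] f

/-- The weak derivative `D^k u ∈ L^p(ℝ)`, `0 ≤ k ≤ [α]`. -/
def weakDeriv (u : FracSobolev s α p) (k : Fin (⌊α⌋₊ + 1)) :
    Lp ℝ (p : ℝ≥0∞) (volume : Measure ℝ) :=
  (u.2.1 k).choose

/-- The weak fractional derivative of order `α` in `L^p(ℝ)`. -/
def fracDeriv (u : FracSobolev s α p) : Lp ℝ (p : ℝ≥0∞) (volume : Measure ℝ) :=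
  u.2.2.choose

theorem weakDeriv_spec (u : FracSobolev s α p) (k : Fin (⌊α⌋₊ + 1)) :
    HasWeakDeriv k (toLp u) (weakDeriv u k) :=
  (u.2.1 k).choose_spec

theorem fracDeriv_spec (u : FracSobolev s α p) :
    HasWeakFracDeriv s α (toLp u) (fracDeriv u) :=
  u.2.2.choose_spec

/-- The norm of `W^{m,p}(ℝ)`, `m = [α]`. -/
def sobolevNorm (u : FracSobolev s α p) : ℝ :=
  (∑ k : Fin (⌊α⌋₊ + 1), ‖weakDeriv u k‖ ^ (p : ℝ)) ^ (1 / (p : ℝ))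

/-- The norm `(‖u‖_{W^{m,p}}^p + ‖D^α u‖_{L^p}^p)^{1/p}` of `^±W^{α,p}(ℝ)`. -/
instance : Norm (FracSobolev s α p) :=
  ⟨fun u => (sobolevNorm u ^ (p : ℝ) + ‖fracDeriv u‖ ^ (p : ℝ)) ^ (1 / (p : ℝ))⟩

/-- All the weak derivatives that enter the norm, as one linear map. -/
def jet : FracSobolev s α p →ₗ[ℝ]
    WithLp (p : ℝ≥0∞)
      (PiLp (p : ℝ≥0∞) (fun _ : Fin (⌊α⌋₊ + 1) => Lp ℝ (p : ℝ≥0∞) (volume : Measure ℝ)) ×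
        Lp ℝ (p : ℝ≥0∞) (volume : Measure ℝ)) where
  toFun u := WithLp.toLp _ (WithLp.toLp _ (weakDeriv u), fracDeriv u)
  map_add' u v := by
    have h1 : weakDeriv (u + v) = weakDeriv u + weakDeriv v := by
      funext k
      have h := (HasWeakDual.add (weakDeriv_spec u k) (weakDeriv_spec v k)).congr
        (u' := toLp (u + v)) (by rw [map_add]; exact Lp.coeFn_add _ _)
        (Lp.coeFn_add (weakDeriv u k) (weakDeriv v k))
      exact Lp.ext (HasWeakDual.unique (weakDeriv_spec (u + v) k) h)
    have h2 : fracDeriv (u + v) = fracDeriv u + fracDeriv v := by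
      have h := (HasWeakDual.add (fracDeriv_spec u) (fracDeriv_spec v)).congr
        (u' := toLp (u + v)) (by rw [map_add]; exact Lp.coeFn_add _ _)
        (Lp.coeFn_add (fracDeriv u) (fracDeriv v))
      exact Lp.ext (HasWeakDual.unique (fracDeriv_spec (u + v)) h)
    rw [h1, h2]
    rfl
  map_smul' c u := by
    have h1 : weakDeriv (c • u) = c • weakDeriv u := by
      funext k
      have h := (HasWeakDual.smul c (weakDeriv_spec u k)).congr
        (u' := toLp (c • u)) (by rw [map_smul]; exact Lp.coeFn_smul _ _)
        (Lp.coeFn_smul c (weakDeriv u k))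
      exact Lp.ext (HasWeakDual.unique (weakDeriv_spec (c • u) k) h)
    have h2 : fracDeriv (c • u) = c • fracDeriv u := by
      have h := (HasWeakDual.smul c (fracDeriv_spec u)).congr
        (u' := toLp (c • u)) (by rw [map_smul]; exact Lp.coeFn_smul _ _)
        (Lp.coeFn_smul c (fracDeriv u))
      exact Lp.ext (HasWeakDual.unique (fracDeriv_spec (c • u)) h)
    rw [h1, h2]
    rfl

theorem toLp_eq_weakDeriv_zero (u : FracSobolev s α p) (h1 : 1 ≤ (p : ℝ≥0∞)) :
    toLp u = weakDeriv u 0 := by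
  have hl : LocallyIntegrable (toLp u : ℝ → ℝ) volume := (Lp.memLp (toLp u)).locallyIntegrable h1
  have h : HasWeakDeriv ((0 : Fin (⌊α⌋₊ + 1)) : ℕ) (toLp u) (toLp u) := by
    refine ⟨hl, fun φ hφ => ?_⟩
    simpa using hφ.integrable_mul hl
  exact Lp.ext (HasWeakDual.unique h (weakDeriv_spec u 0))

/-- The elements of `^±W^{α,p}(ℝ)` that lie in `C_0^∞(ℝ)`. -/
def testFunctions (s : Side) (α : ℝ) (p : ℝ≥0) : Set (FracSobolev s α p) :=
  {u | ∃ φ : ℝ → ℝ, IsTestFunction φ ∧ Represents φ u}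

theorem Represents.add {f g : ℝ → ℝ} {u v : FracSobolev s α p} (hf : Represents f u)
    (hg : Represents g v) : Represents (fun x => f x + g x) (u + v) := by
  have h := Lp.coeFn_add (toLp u) (toLp v)
  rw [← map_add] at h
  filter_upwards [h, hf, hg] with x h1 h2 h3
  rw [h1, Pi.add_apply, h2, h3]

theorem Represents.smul {f : ℝ → ℝ} {u : FracSobolev s α p} (c : ℝ) (hf : Represents f u) :
    Represents (fun x => c * f x) (c • u) := by
  have h := Lp.coeFn_smul c (toLp u)
  rw [← map_smul] at h
  filter_upwards [h, hf] with x h1 h2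
  rw [h1, Pi.smul_apply, h2, smul_eq_mul]

theorem Represents.zero : Represents (fun _ => 0) (0 : FracSobolev s α p) := by
  have h := Lp.coeFn_zero ℝ (p : ℝ≥0∞) (volume : Measure ℝ)
  rw [← map_zero (toLp : FracSobolev s α p →ₗ[ℝ] _)] at h
  exact h

/-- The functions in `C^∞(ℝ)` of finite `^±W^{α,p}(ℝ)` norm. -/
def smoothFunctions (s : Side) (α : ℝ) (p : ℝ≥0) : Submodule ℝ (FracSobolev s α p) where
  carrier := {u | ∃ f : ℝ → ℝ, ContDiff ℝ ∞ f ∧ Represents f u}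
  add_mem' := by
    rintro u v ⟨f, hf, hfu⟩ ⟨g, hg, hgv⟩
    exact ⟨_, hf.add hg, hfu.add hgv⟩
  zero_mem' := ⟨_, contDiff_const, Represents.zero⟩
  smul_mem' := by
    rintro c u ⟨f, hf, hfu⟩
    exact ⟨_, contDiff_const.mul hf, hfu.smul c⟩

/-- `f` vanishes on `(c, ∞)` (`left`), on `(-∞, c)` (`right`). -/
def VanishesBeyond (s : Side) (c : ℝ) (f : ℝ → ℝ) : Prop :=
  match s with
  | Side.left => ∀ x, c < x → f x = 0
  | Side.right => ∀ x, x < c → f x = 0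

/-- The one-side supported functions, `^±C_0^∞(ℝ)`, of finite `^±W^{α,p}(ℝ)` norm. -/
def oneSidedFunctions (s : Side) (α : ℝ) (p : ℝ≥0) : Submodule ℝ (FracSobolev s α p) where
  carrier := {u | ∃ f : ℝ → ℝ, ContDiff ℝ ∞ f ∧ (∃ c, VanishesBeyond s c f) ∧ Represents f u}
  add_mem' := by
    rintro u v ⟨f, hf, ⟨c, hc⟩, hfu⟩ ⟨g, hg, ⟨d, hd⟩, hgv⟩
    refine ⟨_, hf.add hg, ?_, hfu.add hgv⟩
    cases s with
    | left =>
      exact ⟨max c d, fun x hx => by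
        simp [hc x ((le_max_left c d).trans_lt hx), hd x ((le_max_right c d).trans_lt hx)]⟩
    | right =>
      exact ⟨min c d, fun x hx => by
        simp [hc x (hx.trans_le (min_le_left c d)), hd x (hx.trans_le (min_le_right c d))]⟩
  zero_mem' := by
    refine ⟨_, contDiff_const, ⟨0, ?_⟩, Represents.zero⟩
    cases s <;> exact fun x _ => rfl
  smul_mem' := by
    rintro a u ⟨f, hf, ⟨c, hc⟩, hfu⟩
    refine ⟨_, contDiff_const.mul hf, ⟨c, ?_⟩, hfu.smul a⟩
    cases s <;> exact fun x hx => by simp [hc x hx]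

variable [Fact (1 ≤ (p : ℝ≥0∞))]

theorem norm_eq_norm_jet (u : FracSobolev s α p) : ‖u‖ = ‖jet u‖ := by
  have hp : 0 < (p : ℝ≥0∞).toReal :=
    ENNReal.toReal_pos (zero_lt_one.trans_le (Fact.out : 1 ≤ (p : ℝ≥0∞))).ne' (by simp)
  rw [WithLp.prod_norm_eq_add hp, PiLp.norm_eq_sum hp]
  rfl

theorem jet_injective : Function.Injective (jet : FracSobolev s α p →ₗ[ℝ] _) := by
  intro u v h
  have h0 : weakDeriv u 0 = weakDeriv v 0 := congrArg (fun z => z.fst 0) h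
  rw [← toLp_eq_weakDeriv_zero u Fact.out, ← toLp_eq_weakDeriv_zero v Fact.out] at h0
  exact Subtype.ext h0

theorem normCore : NormedSpace.Core ℝ (FracSobolev s α p) where
  norm_nonneg u := by rw [norm_eq_norm_jet]; exact norm_nonneg _
  norm_smul c u := by rw [norm_eq_norm_jet, norm_eq_norm_jet, map_smul, norm_smul]
  norm_triangle u v := by
    rw [norm_eq_norm_jet, norm_eq_norm_jet, norm_eq_norm_jet, map_add]; exact norm_add_le _ _
  norm_eq_zero_iff u := by
    rw [norm_eq_norm_jet, norm_eq_zero, map_eq_zero_iff _ jet_injective]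

instance : NormedAddCommGroup (FracSobolev s α p) :=
  NormedAddCommGroup.ofCore normCore

instance : NormedSpace ℝ (FracSobolev s α p) :=
  NormedSpace.ofCore normCore

end FracSobolev

end Spaces

/-- The completion of a subspace `V` of a normed space `E` is `E` itself: the inclusion of `V`
extends to a linear isometric isomorphism of the abstract completion of `V` onto `E`. -/
def CompletionEquals {E : Type*} [NormedAddCommGroup E] [NormedSpace ℝ E]
    (V : Submodule ℝ E) : Prop :=
  ∃ Φ : UniformSpace.Completion V ≃ₗᵢ[ℝ] E, ∀ v : V, Φ (v : UniformSpace.Completion V) = v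

end

open scoped Convolution

/-! ### Test functions -/

/-! Every derivative in the norm, integer or fractional, is defined by pairing `u` with `T φ`, where
`T` commutes with translations and maps test functions into every `L^q` (`IsTranslationOperator`).
For Riemann–Liouville derivatives the membership in `L^q` is the analytic input. With `σ = n - α ∈
(0, 1]`, the left derivative of `φ` is the convolution of `t_+^{σ-1}/Γ(σ)` with `φ^{(n)}`. It
vanishes far to the left and, after one integration by parts, decays like `x^{σ-2}` to the right, so
it is bounded and integrable. Reflection gives the right side.

Since the left and right derivatives are adjoint on test functions, a test function has a weak
fractional derivative, its classical one up to sign, and so lies in the space.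

Density rests on two ways of differentiating `η * u`. Putting the derivative on `u` gives `η_j * Du
→ Du` in `L^p`, so mollification converges in the full norm (`tendsto_mollify`). Putting it on a
fixed `η` gives `(Dη) * u` with `Dη ∈ L^1`, so `u ↦ η * u` is continuous from `L^p` alone into the
space (`continuous_mollify`). Hence `u` may be replaced by a compactly supported `g` close to it
merely in `L^p`, and `η * g` is a test function. No cut-off of `u`, and no product rule for the
nonlocal derivative, is needed.

Weak derivatives survive `L^p` limits, so the space is complete. It is then the completion of each
of its dense subspaces, in particular of the two that contain the test functions. -/

theorem IsTestFunction.deriv {φ : ℝ → ℝ} (h : IsTestFunction φ) : IsTestFunction (deriv φ) :=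
  ⟨by simpa using h.1.iterate_deriv 1, h.2.deriv⟩

theorem IsTestFunction.iteratedDeriv {φ : ℝ → ℝ} (h : IsTestFunction φ) (n : ℕ) :
    IsTestFunction (iteratedDeriv n φ) := by
  induction n with
  | zero => simpa using h
  | succ n ih => rw [iteratedDeriv_succ]; exact ih.deriv

theorem IsTestFunction.comp_add_right {φ : ℝ → ℝ} (h : IsTestFunction φ) (t : ℝ) :
    IsTestFunction (fun x => φ (x + t)) :=
  ⟨h.1.comp (contDiff_id.add contDiff_const),
    h.2.comp_homeomorph (Homeomorph.addRight t)⟩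

theorem IsTestFunction.comp_neg {φ : ℝ → ℝ} (h : IsTestFunction φ) :
    IsTestFunction (fun x => φ (-x)) :=
  ⟨h.1.comp contDiff_neg, h.2.comp_homeomorph (Homeomorph.neg ℝ)⟩

theorem IsTestFunction.memLp {φ : ℝ → ℝ} (h : IsTestFunction φ) (q : ℝ≥0∞) :
    MemLp φ q volume :=
  h.1.continuous.memLp_of_hasCompactSupport h.2

theorem HasCompactSupport.exists_forall_lt_abs {f : ℝ → ℝ} (h : HasCompactSupport f) :
    ∃ R : ℝ, 0 < R ∧ ∀ x, R < |x| → f x = 0 := by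
  obtain ⟨R, hR⟩ := h.isCompact.isBounded.subset_closedBall (0 : ℝ)
  refine ⟨max R 1, by positivity, fun x hx => ?_⟩
  by_contra hne
  have := hR (subset_tsupport f hne)
  rw [Metric.mem_closedBall, dist_zero_right, Real.norm_eq_abs] at this
  exact absurd hx (not_lt.2 (this.trans (le_max_left _ _)))

/-- Integration by parts, `n` times. -/
theorem integral_iteratedDeriv_mul_of_isTestFunction {φ g : ℝ → ℝ} (hφ : IsTestFunction φ)
    (hg : ContDiff ℝ ∞ g) (n : ℕ) :
    ∫ x, iteratedDeriv n φ x * g x = (-1) ^ n * ∫ x, φ x * iteratedDeriv n g x := by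
  induction n generalizing g with
  | zero => simp
  | succ n ih =>
    have hn := hφ.iteratedDeriv n
    have hg' : ContDiff ℝ ∞ (deriv g) := by simpa using hg.iterate_deriv 1
    have key : ∫ x, iteratedDeriv n φ x * deriv g x =
        -∫ x, iteratedDeriv (n + 1) φ x * g x := by
      rw [iteratedDeriv_succ]
      refine integral_mul_deriv_eq_deriv_mul_of_integrable
        (fun x _ => ((hn.1.differentiable (by simp)) x).hasDerivAt)
        (fun x _ => ((hg.differentiable (by simp)) x).hasDerivAt) ?_ ?_ ?_
      · exact (hn.1.continuous.mul hg'.continuous).integrable_of_hasCompactSupport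
          hn.2.mul_right
      · exact (hn.deriv.1.continuous.mul hg.continuous).integrable_of_hasCompactSupport
          hn.deriv.2.mul_right
      · exact (hn.1.continuous.mul hg.continuous).integrable_of_hasCompactSupport
          hn.2.mul_right
    rw [iteratedDeriv_succ' (f := g), pow_succ]
    linear_combination key - ih hg'

/-- A bounded integrable function lies in all the spaces `L^q`. -/
theorem MeasureTheory.Integrable.memLp_of_bound {X : Type*} [MeasurableSpace X] {μ : Measure X}
    {f : X → ℝ} (hf : Integrable f μ) {C : ℝ} (hC : ∀ x, |f x| ≤ C) {q : ℝ≥0∞} (hq : 1 ≤ q) :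
    MemLp f q μ := by
  rcases eq_or_ne q ∞ with rfl | hq'
  · exact memLp_top_of_bound hf.1 C (ae_of_all _ hC)
  have h1 : 1 ≤ q.toReal := by
    simpa using (ENNReal.toReal_le_toReal (by simp) hq').2 hq
  rw [← integrable_norm_rpow_iff hf.1 (by positivity) hq']
  -- The domination is `|f|^q ≤ C^{q-1} |f|`; zeros of `f` are treated apart because the exponent
  -- law used needs a nonzero base.
  refine (hf.norm.const_mul (C ^ (q.toReal - 1))).mono'
    (hf.1.norm.aemeasurable.pow_const _).aestronglyMeasurable (ae_of_all _ fun x => ?_)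
  rw [Real.norm_of_nonneg (by positivity)]
  rcases (norm_nonneg (f x)).eq_or_lt with h0 | h0
  · rw [← h0, Real.zero_rpow (by positivity)]; simp
  · calc ‖f x‖ ^ q.toReal = ‖f x‖ ^ (q.toReal - 1) * ‖f x‖ := by
          rw [← Real.rpow_add_one h0.ne']; congr 1; ring
      _ ≤ C ^ (q.toReal - 1) * ‖f x‖ := by
          refine mul_le_mul_of_nonneg_right ?_ h0.le
          exact Real.rpow_le_rpow h0.le (hC x) (by linarith)

/-! ### The kernel of the left fractional integral -/

/-- The kernel `t_+^{σ-1}/Γ(σ)`. -/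
noncomputable def rieszKernel (σ : ℝ) : ℝ → ℝ :=
  (Ioi 0).indicator fun t => (Real.Gamma σ)⁻¹ * t ^ (σ - 1)

theorem fracIntegral_left_eq_convolution (σ : ℝ) (f : ℝ → ℝ) :
    fracIntegral Side.left σ f =
      rieszKernel σ ⋆[ContinuousLinearMap.mul ℝ ℝ, volume] f := by
  funext x
  rw [convolution_def]
  simp only [fracIntegral]
  rw [← integral_const_mul, ← integral_indicator measurableSet_Iio,
    ← integral_sub_left_eq_self _ volume x]
  refine integral_congr_ae (ae_of_all _ fun t => ?_)
  by_cases ht : 0 < t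
  · simp [rieszKernel, indicator, ht, mul_assoc]
  · simp [rieszKernel, indicator, ht]

/-- The reflection `y ↦ -y` exchanges the two directions; through it right-sided facts are reduced
to left-sided ones. -/
theorem fracIntegral_right_eq_left (σ : ℝ) (f : ℝ → ℝ) (x : ℝ) :
    fracIntegral Side.right σ f x = fracIntegral Side.left σ (fun y => f (-y)) (-x) := by
  simp only [fracIntegral]
  congr 1
  rw [← integral_indicator measurableSet_Iio, ← integral_indicator measurableSet_Ioi,
    ← integral_neg_eq_self]
  refine integral_congr_ae (ae_of_all _ fun t => ?_)
  by_cases ht : x < -t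
  · have : t < -x := by linarith
    simp only [indicator, mem_Ioi, mem_Iio, ht, this, if_true]
    rw [show -t - x = -x - t by ring]
  · have : ¬ t < -x := by linarith
    simp [indicator, ht, this]

/-- The only singularity is at `0`, with exponent `σ - 1 > -1`. -/
theorem locallyIntegrable_rieszKernel {σ : ℝ} (hσ : 0 < σ) :
    LocallyIntegrable (rieszKernel σ) volume := by
  refine (locallyIntegrable_iff).2 fun K hK => ?_
  obtain ⟨R, hR⟩ := hK.isBounded.subset_closedBall (0 : ℝ)
  have h1 : IntegrableOn (fun t : ℝ => t ^ (σ - 1)) (Icc (-R) R) volume := by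
    rcases le_or_gt 0 R with h0 | h0
    · have := intervalIntegral.intervalIntegrable_rpow' (a := -R) (b := R) (r := σ - 1)
        (by linarith)
      rwa [intervalIntegrable_iff_integrableOn_Icc_of_le (by linarith)] at this
    · rw [Icc_eq_empty (by linarith)]; exact integrableOn_empty
  have h2 : IntegrableOn (rieszKernel σ) (Icc (-R) R) volume :=
    (h1.const_mul ((Real.Gamma σ)⁻¹)).indicator measurableSet_Ioi
  refine h2.mono_set (hR.trans ?_)
  rw [Real.closedBall_eq_Icc]; simp

/-- All derivatives fall on the test function, so local integrability of the kernel suffices. -/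
theorem iteratedDeriv_convolution_right {k φ : ℝ → ℝ} (hk : LocallyIntegrable k volume)
    (hφ : IsTestFunction φ) (n : ℕ) :
    iteratedDeriv n (k ⋆[ContinuousLinearMap.mul ℝ ℝ, volume] φ) =
      k ⋆[ContinuousLinearMap.mul ℝ ℝ, volume] (iteratedDeriv n φ) := by
  induction n with
  | zero => simp
  | succ n ih =>
    rw [iteratedDeriv_succ, ih, iteratedDeriv_succ]
    funext x
    exact ((hφ.iteratedDeriv n).2.hasDerivAt_convolution_right _ hk
      ((hφ.iteratedDeriv n).1.of_le (by simp)) x).deriv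

theorem contDiff_convolution_right {k φ : ℝ → ℝ} (hk : LocallyIntegrable k volume)
    (hφ : IsTestFunction φ) :
    ContDiff ℝ ∞ (k ⋆[ContinuousLinearMap.mul ℝ ℝ, volume] φ) :=
  hφ.2.contDiff_convolution_right _ hk (n := ⊤) hφ.1

/-! ### The Riemann-Liouville derivative of a test function -/

theorem order_gap_pos (α : ℝ) : 0 < ((⌊α⌋₊ + 1 : ℕ) : ℝ) - α := by
  have := Nat.lt_floor_add_one α
  push_cast; linarith

theorem order_gap_le_one {α : ℝ} (hα : 0 ≤ α) : ((⌊α⌋₊ + 1 : ℕ) : ℝ) - α ≤ 1 := by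
  have := Nat.floor_le hα
  push_cast; linarith

theorem rlDeriv_left_eq_convolution (α : ℝ) {φ : ℝ → ℝ} (hφ : IsTestFunction φ) :
    rlDeriv Side.left α φ = rieszKernel ((⌊α⌋₊ + 1 : ℕ) - α)
      ⋆[ContinuousLinearMap.mul ℝ ℝ, volume] (iteratedDeriv (⌊α⌋₊ + 1) φ) := by
  funext x
  simp only [rlDeriv]
  rw [fracIntegral_left_eq_convolution,
    iteratedDeriv_convolution_right (locallyIntegrable_rieszKernel (order_gap_pos α)) hφ]

theorem rlDeriv_right_eq_left (α : ℝ) (φ : ℝ → ℝ) (x : ℝ) :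
    rlDeriv Side.right α φ x = rlDeriv Side.left α (fun y => φ (-y)) (-x) := by
  simp only [rlDeriv]
  have : fracIntegral Side.right ((⌊α⌋₊ + 1 : ℕ) - α) φ = fun x =>
      fracIntegral Side.left ((⌊α⌋₊ + 1 : ℕ) - α) (fun y => φ (-y)) (-x) :=
    funext fun x => fracIntegral_right_eq_left _ _ x
  rw [this, iteratedDeriv_comp_neg, smul_eq_mul, ← mul_assoc, ← mul_pow]
  simp

theorem fracIntegral_left_comp_add_right (σ : ℝ) (φ : ℝ → ℝ) (t : ℝ) :
    fracIntegral Side.left σ (fun x => φ (x + t)) =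
      fun x => fracIntegral Side.left σ φ (x + t) := by
  funext x
  rw [fracIntegral_left_eq_convolution, fracIntegral_left_eq_convolution, convolution_def,
    convolution_def]
  refine integral_congr_ae (ae_of_all _ fun y => ?_)
  simp only
  rw [sub_add_eq_add_sub]

theorem rlDeriv_comp_add_right (s : Side) (α : ℝ) (φ : ℝ → ℝ) (t : ℝ) :
    rlDeriv s α (fun x => φ (x + t)) = fun x => rlDeriv s α φ (x + t) := by
  have hl : ∀ (ψ : ℝ → ℝ) (t : ℝ), rlDeriv Side.left α (fun x => ψ (x + t)) =
      fun x => rlDeriv Side.left α ψ (x + t) := by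
    intro ψ t
    funext x
    simp only [rlDeriv]
    rw [fracIntegral_left_comp_add_right, iteratedDeriv_comp_add_const]
  cases s with
  | left => exact hl φ t
  | right =>
    funext x
    rw [rlDeriv_right_eq_left, rlDeriv_right_eq_left]
    have := congrFun (hl (fun y => φ (-y)) (-t)) (-x)
    simp only [neg_add, neg_neg] at this ⊢
    exact this

/-- The kernel lives on `t > 0`, so the value at `x` only sees `ψ` to the left of `x`. -/
theorem convolution_rieszKernel_eq_zero {σ R x : ℝ} {ψ : ℝ → ℝ}
    (hR : ∀ x, R < |x| → ψ x = 0) (hx : x < -R) :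
    (rieszKernel σ ⋆[ContinuousLinearMap.mul ℝ ℝ, volume] ψ) x = 0 := by
  rw [convolution_def]
  refine integral_eq_zero_of_ae (ae_of_all _ fun t => ?_)
  by_cases ht : 0 < t
  · have : ψ (x - t) = 0 := hR _ (by rw [lt_abs]; right; linarith)
    simp [this]
  · simp [rieszKernel, indicator, ht]

/-- To the right of the support the kernel is smooth, so the derivative can be moved onto it. This
improves the decay from `x^{σ-1}`, which is not integrable, to `x^{σ-2}`. -/
theorem convolution_rieszKernel_deriv_eq {σ R x : ℝ} {ψ : ℝ → ℝ} (hψ : IsTestFunction ψ)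
    (hR0 : 0 < R) (hR : ∀ x, R < |x| → ψ x = 0) (hx : R + 1 < x) :
    (rieszKernel σ ⋆[ContinuousLinearMap.mul ℝ ℝ, volume] (deriv ψ)) x =
      (Real.Gamma σ)⁻¹ * (σ - 1) *
        ∫ y in (-(R + 1))..(R + 1), (x - y) ^ (σ - 2) * ψ y := by
  have hd : ∀ y, R < |y| → deriv ψ y = 0 := fun y hy => by
    have : ψ =ᶠ[nhds y] fun _ => 0 := by
      filter_upwards [(isOpen_lt continuous_const continuous_abs).mem_nhds hy] with z hz
        using hR z hz
    rw [this.deriv_eq]; simp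
  -- Vanishing is known for `|x| > R` only; the extra `1` makes the boundary terms at `±(R + 1)`
  -- vanish.
  have hle : -(R + 1) ≤ R + 1 := by linarith
  have e1 : (rieszKernel σ ⋆[ContinuousLinearMap.mul ℝ ℝ, volume] (deriv ψ)) x =
      (Real.Gamma σ)⁻¹ * ∫ y in (-(R + 1))..(R + 1), (x - y) ^ (σ - 1) * deriv ψ y := by
    rw [← fracIntegral_left_eq_convolution, intervalIntegral.integral_of_le hle]
    simp only [fracIntegral]
    congr 1
    refine setIntegral_eq_of_subset_of_forall_sdiff_eq_zero measurableSet_Iio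
      (fun y (hy : y ∈ Ioc _ _) => lt_of_le_of_lt hy.2 hx) fun y hy => ?_
    rw [hd y, mul_zero]
    by_contra hcon
    have := abs_le.1 (not_lt.1 hcon)
    exact hy.2 ⟨by linarith, by linarith⟩
  have hpos : ∀ y ∈ uIcc (-(R + 1)) (R + 1), 0 < x - y := fun y hy => by
    rw [uIcc_of_le hle] at hy; linarith [hy.2]
  rw [e1, intervalIntegral.integral_mul_deriv_eq_deriv_mul (v := ψ)
    (u' := fun y => -((σ - 1) * (x - y) ^ (σ - 2)))
    ?_ (fun y _ => ((hψ.1.differentiable (by simp)) y).hasDerivAt) ?_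
    (hψ.deriv.1.continuous.intervalIntegrable _ _), hR (R + 1), hR (-(R + 1))]
  · rw [mul_zero, mul_zero, sub_zero, zero_sub, ← intervalIntegral.integral_neg, mul_assoc,
      ← intervalIntegral.integral_const_mul (σ - 1)]
    congr 2
    funext y; ring
  · rw [abs_neg, abs_of_pos (by linarith)]; linarith
  · rw [abs_of_pos (by linarith)]; linarith
  · intro y hy
    have := ((hasDerivAt_id y).const_sub x).rpow_const (p := σ - 1) (Or.inl (hpos y hy).ne')
    refine this.congr_deriv ?_
    rw [show σ - 1 - 1 = σ - 2 by ring, id]; ring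
  · refine ContinuousOn.intervalIntegrable (ContinuousOn.neg (continuousOn_const.mul ?_))
    exact ContinuousOn.rpow_const (by fun_prop) fun y hy => Or.inl (hpos y hy).ne'

theorem integrable_and_bounded_convolution_rieszKernel_deriv {σ : ℝ} (hσ : 0 < σ) (hσ1 : σ ≤ 1)
    {ψ : ℝ → ℝ} (hψ : IsTestFunction ψ) :
    Integrable (rieszKernel σ ⋆[ContinuousLinearMap.mul ℝ ℝ, volume] (deriv ψ)) volume ∧
      ∃ C, ∀ x, |(rieszKernel σ ⋆[ContinuousLinearMap.mul ℝ ℝ, volume] (deriv ψ)) x| ≤ C := by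
  set g := rieszKernel σ ⋆[ContinuousLinearMap.mul ℝ ℝ, volume] (deriv ψ) with hg
  have hcont : Continuous g :=
    (contDiff_convolution_right (locallyIntegrable_rieszKernel hσ) hψ.deriv).continuous
  obtain ⟨R, hR0, hR⟩ := hψ.2.exists_forall_lt_abs
  obtain ⟨R', hR0', hR'⟩ := hψ.deriv.2.exists_forall_lt_abs
  have hleft : ∀ x, x < -R' → g x = 0 := fun x hx =>
    convolution_rieszKernel_eq_zero hR' hx
  obtain ⟨B, hB⟩ := hψ.1.continuous.bounded_above_of_compact_support hψ.2
  have hB0 : 0 ≤ B := (norm_nonneg _).trans (hB 0)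
  -- For `x > 2(R + 1)` and `y ≤ R + 1` one has `x - y ≥ x/2`, so `(x - y)^{σ-2} ≤ (x/2)^{σ-2}`;
  -- moreover `|ψ| ≤ B`, and the interval has length `2(R + 1)`.
  set D : ℝ := |(Real.Gamma σ)⁻¹| * (2⁻¹ ^ (σ - 2) * B * (2 * (R + 1))) with hD
  have hD0 : 0 ≤ D := by positivity
  have hright : ∀ x, 2 * (R + 1) < x → |g x| ≤ D * ((1 - σ) * x ^ (σ - 2)) := by
    intro x hx
    have hx0 : 0 < x := by linarith
    rw [hg, convolution_rieszKernel_deriv_eq hψ hR0 hR (by linarith), abs_mul, abs_mul,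
      abs_sub_comm σ 1, abs_of_nonneg (sub_nonneg.2 hσ1)]
    have hI : |∫ y in (-(R + 1))..(R + 1), (x - y) ^ (σ - 2) * ψ y| ≤
        (2⁻¹ ^ (σ - 2) * x ^ (σ - 2) * B) * |(R + 1) - -(R + 1)| := by
      rw [← Real.norm_eq_abs]
      refine intervalIntegral.norm_integral_le_of_norm_le_const fun y hy => ?_
      rw [uIoc_of_le (by linarith)] at hy
      have hxy : 2⁻¹ * x ≤ x - y := by linarith [hy.2]
      rw [norm_mul, Real.norm_of_nonneg (Real.rpow_nonneg (by linarith) _),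
        ← Real.mul_rpow (by norm_num) hx0.le]
      refine mul_le_mul ?_ (hB y) (norm_nonneg _) (by positivity)
      exact Real.rpow_le_rpow_of_nonpos (by positivity) hxy (by linarith)
    rw [show (R + 1) - -(R + 1) = 2 * (R + 1) by ring, abs_of_pos (by linarith : 0 < 2 * (R + 1))]
      at hI
    calc _ ≤ |(Real.Gamma σ)⁻¹| * (1 - σ) *
          ((2⁻¹ ^ (σ - 2) * x ^ (σ - 2) * B) * (2 * (R + 1))) := by
            refine mul_le_mul_of_nonneg_left hI (mul_nonneg (abs_nonneg _) (by linarith))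
      _ = _ := by rw [hD]; ring
  obtain ⟨M, hM⟩ := (isCompact_Icc (a := -R') (b := 2 * (R + 1))).exists_bound_of_continuousOn
    hcont.continuousOn
  constructor
  · have h1 : IntegrableOn g (Iio (-R')) volume :=
      integrableOn_zero.congr_fun (fun x hx => (hleft x hx).symm) measurableSet_Iio
    have h2 : IntegrableOn g (Icc (-R') (2 * (R + 1))) volume :=
      hcont.continuousOn.integrableOn_compact isCompact_Icc
    have h3 : IntegrableOn g (Ioi (2 * (R + 1))) volume := by
      have hb : IntegrableOn (fun x : ℝ => D * ((1 - σ) * x ^ (σ - 2))) (Ioi (2 * (R + 1)))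
          volume := by
        -- For `σ = 1` (integer `α`) the power `x^{-1}` is not integrable, but the factor `1 - σ`,
        -- kept in the bound for this case, is zero.
        rcases eq_or_lt_of_le hσ1 with rfl | h
        · simp
        · exact ((integrableOn_Ioi_rpow_of_lt (by linarith) (by linarith)).const_mul _).const_mul _
      refine Integrable.mono' hb hcont.aestronglyMeasurable ?_
      filter_upwards [ae_restrict_mem measurableSet_Ioi] with x hx using hright x hx
    rw [← integrableOn_univ]
    refine ((h1.union h2).union h3).mono_set fun x _ => ?_
    rcases lt_or_ge x (-R') with h | h
    · exact Or.inl (Or.inl h)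
    · rcases le_or_gt x (2 * (R + 1)) with h' | h'
      · exact Or.inl (Or.inr ⟨h, h'⟩)
      · exact Or.inr h'
  · refine ⟨max (max M 0) (D * ((1 - σ) * (2 * (R + 1)) ^ (σ - 2))), fun x => ?_⟩
    rcases lt_or_ge x (-R') with h | h
    · rw [hleft x h, abs_zero]; exact (le_max_right _ _).trans (le_max_left _ _)
    · rcases le_or_gt x (2 * (R + 1)) with h' | h'
      · exact (hM x ⟨h, h'⟩).trans ((le_max_left _ _).trans (le_max_left _ _))
      · refine (hright x h').trans (le_trans ?_ (le_max_right _ _))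
        refine mul_le_mul_of_nonneg_left (mul_le_mul_of_nonneg_left ?_ (by linarith)) hD0
        exact Real.rpow_le_rpow_of_nonpos (by linarith) h'.le (by linarith)

/-- Since `n ≥ 1`, one derivative can be split off: the decay estimate applies with `ψ = φ^{(n-1)}`.
-/
theorem rlDeriv_integrable_and_bounded (s : Side) {α : ℝ} (hα : 0 ≤ α) {φ : ℝ → ℝ}
    (hφ : IsTestFunction φ) :
    Integrable (rlDeriv s α φ) volume ∧ ∃ C, ∀ x, |rlDeriv s α φ x| ≤ C := by
  have hl : ∀ {φ : ℝ → ℝ}, IsTestFunction φ → Integrable (rlDeriv Side.left α φ) volume ∧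
      ∃ C, ∀ x, |rlDeriv Side.left α φ x| ≤ C := by
    intro φ hφ
    rw [rlDeriv_left_eq_convolution α hφ, iteratedDeriv_succ]
    exact integrable_and_bounded_convolution_rieszKernel_deriv (order_gap_pos α) (order_gap_le_one hα)
      (hφ.iteratedDeriv _)
  cases s with
  | left => exact hl hφ
  | right =>
    obtain ⟨h1, C, hC⟩ := hl hφ.comp_neg
    have e : rlDeriv Side.right α φ = fun x => rlDeriv Side.left α (fun y => φ (-y)) (-x) :=
      funext fun x => rlDeriv_right_eq_left α φ x
    rw [e]
    exact ⟨h1.comp_neg, C, fun x => hC _⟩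

theorem rlDeriv_memLp (s : Side) {α : ℝ} (hα : 0 ≤ α) {φ : ℝ → ℝ} (hφ : IsTestFunction φ)
    {q : ℝ≥0∞} (hq : 1 ≤ q) : MemLp (rlDeriv s α φ) q volume := by
  obtain ⟨h1, C, hC⟩ := rlDeriv_integrable_and_bounded s hα hφ
  exact h1.memLp_of_bound hC hq

/-! ### Exchange of integrals -/

section Fubini

variable {p q : ℝ≥0∞} [p.HolderConjugate q] {k f g : ℝ → ℝ}

/-- By Hölder and translation invariance, the inner integral of the absolute value is at most
`|k(t)| ‖f‖_p ‖g‖_q`. -/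
theorem integrable_prod_mul_translate (hk : Integrable k volume) (hf : MemLp f p volume)
    (hg : MemLp g q volume) :
    Integrable (fun z : ℝ × ℝ => k z.1 * (f z.2 * g (z.2 + z.1))) (volume.prod volume) := by
  have hgt : ∀ t : ℝ, MemLp (fun x => g (x + t)) q volume := fun t =>
    hg.comp_measurePreserving (measurePreserving_add_right volume t)
  have hmeas : AEStronglyMeasurable (fun z : ℝ × ℝ => g (z.2 + z.1)) (volume.prod volume) := by
    have h := hg.1.comp_quasiMeasurePreserving
      (Measure.quasiMeasurePreserving_fst.comp
        (measurePreserving_add_prod (volume : Measure ℝ) volume).quasiMeasurePreserving)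
    refine h.congr (ae_of_all _ fun z => ?_)
    simp [add_comm]
  have hm : AEStronglyMeasurable (fun z : ℝ × ℝ => k z.1 * (f z.2 * g (z.2 + z.1)))
      (volume.prod volume) := hk.1.comp_fst.mul (hf.1.comp_snd.mul hmeas)
  rw [integrable_prod_iff hm]
  refine ⟨ae_of_all _ fun t => (hf.integrable_mul (hgt t)).const_mul (k t), ?_⟩
  refine (hk.norm.mul_const ((eLpNorm f p volume * eLpNorm g q volume).toReal)).mono'
    hm.norm.integral_prod_right' (ae_of_all _ fun t => ?_)
  rw [Real.norm_of_nonneg (integral_nonneg fun x => norm_nonneg _)]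
  simp only [norm_mul (k t)]
  rw [integral_const_mul]
  refine mul_le_mul_of_nonneg_left ?_ (norm_nonneg _)
  refine (integral_norm_eq_lintegral_enorm (hf.integrable_mul (hgt t)).1).trans_le ?_
  refine ENNReal.toReal_mono (ENNReal.mul_ne_top hf.2.ne hg.2.ne) ?_
  have h1 := eLpNorm_smul_le_mul_eLpNorm (r := 1) (hgt t).1 hf.1 (p := p) (q := q)
  rw [eLpNorm_one_eq_lintegral_enorm] at h1
  refine h1.trans_eq ?_
  rw [show (fun x => g (x + t)) = g ∘ (fun x => x + t) from rfl,
    eLpNorm_comp_measurePreserving hg.1 (measurePreserving_add_right volume t)]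

theorem integral_mul_integral_translate (hk : Integrable k volume) (hf : MemLp f p volume)
    (hg : MemLp g q volume) :
    ∫ t, k t * ∫ x, f x * g (x + t) = ∫ x, f x * ∫ t, k t * g (x + t) := by
  have h := integral_integral_swap (f := fun t x => k t * (f x * g (x + t)))
    (integrable_prod_mul_translate hk hf hg)
  simp only [integral_const_mul] at h
  rw [h]
  refine integral_congr_ae (ae_of_all _ fun x => ?_)
  simp only [← integral_const_mul]
  refine integral_congr_ae (ae_of_all _ fun t => ?_)
  simp only; ring

theorem integral_convolution_mul (hk : Integrable k volume) (hf : MemLp f p volume)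
    (hg : MemLp g q volume) :
    ∫ x, (∫ t, k t * f (x - t)) * g x = ∫ x, f x * ∫ t, k t * g (x + t) := by
  rw [← integral_mul_integral_translate hk hf hg]
  have h := integral_mul_integral_translate hk.comp_neg hg hf
  calc ∫ x, (∫ t, k t * f (x - t)) * g x = ∫ x, g x * ∫ t, k (-t) * f (x + t) := by
        refine integral_congr_ae (ae_of_all _ fun x => ?_)
        simp only
        rw [mul_comm, ← integral_neg_eq_self]
        simp
    _ = ∫ t, k t * ∫ x, g x * f (x - t) := by
        rw [← h, ← integral_neg_eq_self]
        simp [sub_eq_add_neg]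
    _ = _ := by
        refine integral_congr_ae (ae_of_all _ fun t => ?_)
        simp only
        rw [← integral_add_right_eq_self _ t]
        simp [mul_comm]

end Fubini

/-! ### Duality of the two Riemann-Liouville derivatives -/

/-- The Riesz kernel is not in `L^1`, but `φ(x - t) ψ(x) ≠ 0` forces `|t| ≤ R + S`, so the kernel
may be truncated there. -/
theorem integral_convolution_mul_of_hasCompactSupport {k φ ψ : ℝ → ℝ}
    (hk : LocallyIntegrable k volume) (hφ : IsTestFunction φ) (hψ : IsTestFunction ψ) :
    ∫ x, (∫ t, k t * φ (x - t)) * ψ x = ∫ x, φ x * ∫ t, k t * ψ (x + t) := by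
  obtain ⟨R, hR0, hR⟩ := hφ.2.exists_forall_lt_abs
  obtain ⟨S, hS0, hS⟩ := hψ.2.exists_forall_lt_abs
  set k' := (Icc (-(R + S)) (R + S)).indicator k with hk'
  have hki : Integrable k' volume :=
    (integrable_indicator_iff measurableSet_Icc).2 (hk.integrableOn_isCompact isCompact_Icc)
  have key : ∀ x y t, y = x - t → k t * φ y * ψ x = k' t * φ y * ψ x := by
    rintro x y t rfl
    by_cases ht : t ∈ Icc (-(R + S)) (R + S)
    · rw [hk', indicator_of_mem ht]
    by_cases hx : S < |x|
    · rw [hS x hx]; simp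
    · rw [hR (x - t)]
      · simp
      by_contra hc
      have h1 := abs_le.1 (not_lt.1 hx)
      have h2 := abs_le.1 (not_lt.1 hc)
      exact ht ⟨by linarith, by linarith⟩
  have h := integral_convolution_mul (p := 2) (q := 2) hki (hφ.memLp 2) (hψ.memLp 2)
  convert h using 3 with x x
  · simp only [← integral_mul_const]
    exact congrArg _ (funext fun t => key x (x - t) t rfl)
  · simp only [← integral_const_mul]
    refine congrArg _ (funext fun t => ?_)
    have := key (x + t) x t (by ring)
    linear_combination this

/-- The adjoint of the left fractional integral is the right one, and the sign from moving `n`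
derivatives is the `(-1)^n` built into the right derivative. -/
theorem integral_rlDeriv_left_mul (α : ℝ) {φ ψ : ℝ → ℝ} (hφ : IsTestFunction φ)
    (hψ : IsTestFunction ψ) :
    ∫ x, rlDeriv Side.left α φ x * ψ x = ∫ x, φ x * rlDeriv Side.right α ψ x := by
  set n := ⌊α⌋₊ + 1 with hn
  set σ := ((⌊α⌋₊ + 1 : ℕ) : ℝ) - α with hσ
  have hk := locallyIntegrable_rieszKernel (order_gap_pos α)
  have hR : ∀ x, fracIntegral Side.right σ ψ x = ∫ t, rieszKernel σ t * ψ (x + t) := by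
    intro x
    rw [fracIntegral_right_eq_left, fracIntegral_left_eq_convolution, convolution_def]
    simp [add_comm]
  have hsm : ContDiff ℝ ∞ (fracIntegral Side.right σ ψ) := by
    have e : fracIntegral Side.right σ ψ = fun x =>
        fracIntegral Side.left σ (fun y => ψ (-y)) (-x) :=
      funext fun x => fracIntegral_right_eq_left _ _ x
    rw [e, fracIntegral_left_eq_convolution]
    exact (contDiff_convolution_right hk hψ.comp_neg).comp contDiff_neg
  have h1 := integral_convolution_mul_of_hasCompactSupport hk (hφ.iteratedDeriv n) hψ
  have h2 := integral_iteratedDeriv_mul_of_isTestFunction hφ hsm n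
  rw [rlDeriv_left_eq_convolution α hφ]
  simp only [rlDeriv, convolution_def, ContinuousLinearMap.mul_apply']
  rw [h1]
  simp only [← hσ, ← hR]
  rw [h2, ← integral_const_mul]
  refine integral_congr_ae (ae_of_all _ fun x => ?_)
  simp only; ring

theorem integral_rlDeriv_mul (s : Side) (α : ℝ) {φ ψ : ℝ → ℝ} (hφ : IsTestFunction φ)
    (hψ : IsTestFunction ψ) :
    ∫ x, rlDeriv s α φ x * ψ x = ∫ x, φ x * rlDeriv s.opp α ψ x := by
  cases s with
  | left => exact integral_rlDeriv_left_mul α hφ hψ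
  | right =>
    have := integral_rlDeriv_left_mul α hψ hφ
    simp only [Side.opp]
    simp only [mul_comm] at this ⊢
    exact this.symm

/-- The duality of the classical derivatives carries no sign, so the `(-1)^{[α]}` of the weak
definition reappears in the weak derivative. -/
theorem IsTestFunction.hasWeakFracDeriv (s : Side) {α : ℝ} (hα : 0 ≤ α) {φ : ℝ → ℝ}
    (hφ : IsTestFunction φ) :
    HasWeakFracDeriv s α φ ((-1 : ℝ) ^ ⌊α⌋₊ • rlDeriv s α φ) := by
  refine ⟨((rlDeriv_integrable_and_bounded s hα hφ).1.smul _).locallyIntegrable,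
    fun ψ hψ => ⟨?_, ?_⟩⟩
  · exact MemLp.integrable_mul (p := 1) (q := ∞) (hφ.memLp 1) (rlDeriv_memLp _ hα hψ le_top)
  · simp only [Pi.smul_apply, smul_eq_mul, mul_assoc, integral_const_mul]
    rw [integral_rlDeriv_mul s α hφ hψ]

theorem IsTestFunction.hasWeakDeriv (k : ℕ) {φ : ℝ → ℝ} (hφ : IsTestFunction φ) :
    HasWeakDeriv k φ (_root_.iteratedDeriv k φ) := by
  refine ⟨((hφ.iteratedDeriv k).1.continuous).locallyIntegrable, fun ψ hψ => ⟨?_, ?_⟩⟩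
  · exact MemLp.integrable_mul (p := 1) (q := ∞) (hφ.memLp 1) ((hψ.iteratedDeriv k).memLp _)
  · exact integral_iteratedDeriv_mul_of_isTestFunction hφ hψ.1 k

/-! ### Convolution in `L^p` as a Bochner integral of translates -/

section LpConv

variable {p : ℝ≥0∞} [Fact (1 ≤ p)]

/-- The translate `x ↦ f (x - t)` of `f ∈ L^p(ℝ)`. -/
noncomputable def lpTranslate (t : ℝ) :
    Lp ℝ p (volume : Measure ℝ) →ₗᵢ[ℝ] Lp ℝ p (volume : Measure ℝ) :=
  Lp.compMeasurePreservingₗᵢ ℝ (fun x => x - t) (measurePreserving_sub_right volume t)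

theorem coeFn_lpTranslate (t : ℝ) (f : Lp ℝ p (volume : Measure ℝ)) :
    lpTranslate t f =ᵐ[volume] fun x => f (x - t) :=
  Lp.coeFn_compMeasurePreserving f (measurePreserving_sub_right volume t)

/-- Supplies both the measurability behind the Bochner integral and the convergence of mollifiers;
this is where `p < ∞` enters. -/
theorem continuous_lpTranslate (hp : p ≠ ⊤) (f : Lp ℝ p (volume : Measure ℝ)) :
    Continuous fun t => lpTranslate t f := by
  have hc : Continuous fun t : ℝ => (⟨fun x => x - t, by fun_prop⟩ : C(ℝ, ℝ)) :=
    ContinuousMap.continuous_of_continuous_uncurry _ (by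
      simp only [Function.uncurry_def, ContinuousMap.coe_mk]; fun_prop)
  exact (continuous_const (y := f)).compMeasurePreservingLp hc
    (fun t => measurePreserving_sub_right volume t) hp

theorem lpTranslate_zero (f : Lp ℝ p (volume : Measure ℝ)) : lpTranslate 0 f = f := by
  refine Lp.ext ((coeFn_lpTranslate 0 f).trans ?_)
  simp

/-- The convolution `k * f` of `k ∈ L^1(ℝ)` and `f ∈ L^p(ℝ)`. -/
noncomputable def lpConv (k : ℝ → ℝ) (f : Lp ℝ p (volume : Measure ℝ)) :
    Lp ℝ p (volume : Measure ℝ) :=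
  ∫ t, k t • lpTranslate t f

theorem integrable_smul_lpTranslate (hp : p ≠ ⊤) {k : ℝ → ℝ} (hk : Integrable k volume)
    (f : Lp ℝ p (volume : Measure ℝ)) : Integrable (fun t => k t • lpTranslate t f) volume := by
  refine (hk.norm.mul_const ‖f‖).mono'
    (hk.1.smul (continuous_lpTranslate hp f).aestronglyMeasurable) (ae_of_all _ fun t => ?_)
  rw [norm_smul, LinearIsometry.norm_map]

/-- Young's inequality: translations are isometries of `L^p`. -/
theorem norm_lpConv_le (k : ℝ → ℝ) (f : Lp ℝ p (volume : Measure ℝ)) :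
    ‖lpConv k f‖ ≤ (∫ t, ‖k t‖) * ‖f‖ := by
  refine (norm_integral_le_integral_norm _).trans_eq ?_
  rw [← integral_mul_const]
  simp only [norm_smul, LinearIsometry.norm_map]

theorem lpConv_sub (hp : p ≠ ⊤) {k : ℝ → ℝ} (hk : Integrable k volume)
    (f g : Lp ℝ p (volume : Measure ℝ)) : lpConv k (f - g) = lpConv k f - lpConv k g := by
  simp only [lpConv, map_sub, smul_sub]
  exact integral_sub (integrable_smul_lpTranslate hp hk f) (integrable_smul_lpTranslate hp hk g)

theorem continuous_lpConv (hp : p ≠ ⊤) {k : ℝ → ℝ} (hk : Integrable k volume) :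
    Continuous (lpConv k : Lp ℝ p (volume : Measure ℝ) → _) := by
  refine (LipschitzWith.of_dist_le_mul (K := (∫ t, ‖k t‖).toNNReal) fun f g => ?_).continuous
  rw [dist_eq_norm, dist_eq_norm, ← lpConv_sub hp hk,
    Real.coe_toNNReal _ (integral_nonneg fun t => norm_nonneg _)]
  exact norm_lpConv_le k _

/-- The pairing of `L^p` with a function in the conjugate space. -/
theorem exists_pairing {q : ℝ≥0∞} [p.HolderConjugate q] {g : ℝ → ℝ} (hg : MemLp g q volume) :
    ∃ Λ : Lp ℝ p (volume : Measure ℝ) →L[ℝ] ℝ, ∀ f, Λ f = ∫ x, f x * g x := by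
  have : Fact (1 ≤ q) := ⟨ENNReal.HolderConjugate.one_le q p⟩
  refine ⟨((ContinuousLinearMap.mul ℝ ℝ).lpPairing volume p q).flip (hg.toLp g), fun f => ?_⟩
  rw [ContinuousLinearMap.flip_apply, ContinuousLinearMap.lpPairing_eq_integral]
  refine integral_congr_ae ?_
  filter_upwards [hg.coeFn_toLp] with x hx
  simp [hx]

/-- A continuous functional passes through the Bochner integral. This identifies `lpConv` by its
pairings, without a pointwise formula. -/
theorem integral_lpConv_mul {q : ℝ≥0∞} [p.HolderConjugate q] (hp : p ≠ ⊤) {k g : ℝ → ℝ}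
    (hk : Integrable k volume) (hg : MemLp g q volume) (f : Lp ℝ p (volume : Measure ℝ)) :
    ∫ x, lpConv k f x * g x = ∫ t, k t * ∫ x, f x * g (x + t) := by
  obtain ⟨Λ, hΛ⟩ := exists_pairing (p := p) hg
  rw [← hΛ, lpConv, ← Λ.integral_comp_comm (integrable_smul_lpTranslate hp hk f)]
  refine integral_congr_ae (ae_of_all _ fun t => ?_)
  simp only
  rw [map_smul, smul_eq_mul, hΛ]
  congr 1
  rw [← integral_add_right_eq_self (fun x => f x * g (x + t)) (-t)]
  refine integral_congr_ae ?_
  filter_upwards [coeFn_lpTranslate t f] with x hx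
  simp [hx, sub_eq_add_neg]

/-- An operator on test functions which commutes with translations and has values in `L^q`. -/
structure IsTranslationOperator (T : (ℝ → ℝ) → ℝ → ℝ) : Prop where
  memLp : ∀ {φ}, IsTestFunction φ → ∀ {q : ℝ≥0∞}, 1 ≤ q → MemLp (T φ) q volume
  comp_add_right : ∀ {φ}, IsTestFunction φ → ∀ t x, T (fun x => φ (x + t)) x = T φ (x + t)

theorem isTranslationOperator_iteratedDeriv (k : ℕ) : IsTranslationOperator (iteratedDeriv k) where
  memLp hφ q _ := (hφ.iteratedDeriv k).memLp q
  comp_add_right _ t x := by rw [iteratedDeriv_comp_add_const]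

theorem isTranslationOperator_rlDeriv (s : Side) {α : ℝ} (hα : 0 ≤ α) :
    IsTranslationOperator (rlDeriv s α) where
  memLp hφ _ hq := rlDeriv_memLp s hα hφ hq
  comp_add_right _ t x := by rw [rlDeriv_comp_add_right]

variable {T : (ℝ → ℝ) → ℝ → ℝ} {c : ℝ}

theorem IsTranslationOperator.integrable_mul (hT : IsTranslationOperator T)
    (u : Lp ℝ p (volume : Measure ℝ)) {φ : ℝ → ℝ} (hφ : IsTestFunction φ) :
    Integrable (fun x => u x * T φ x) volume :=
  (Lp.memLp u).integrable_mul (q := p.conjExponent)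
    (hT.memLp hφ (ENNReal.HolderConjugate.one_le _ p))

theorem Lp.locallyIntegrable_coeFn (u : Lp ℝ p (volume : Measure ℝ)) :
    LocallyIntegrable u volume :=
  (Lp.memLp u).locallyIntegrable Fact.out

/-- Convolution preserves weak derivatives. -/
theorem HasWeakDual.lpConv (hT : IsTranslationOperator T) (hp : p ≠ ⊤)
    {u v : Lp ℝ p (volume : Measure ℝ)} (h : HasWeakDual T c u v) {η : ℝ → ℝ}
    (hη : Integrable η volume) : HasWeakDual T c (lpConv η u) (lpConv η v) := by
  refine ⟨Lp.locallyIntegrable_coeFn _, fun φ hφ => ⟨hT.integrable_mul _ hφ, ?_⟩⟩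
  rw [integral_lpConv_mul (q := p.conjExponent) hp hη (hφ.memLp _),
    integral_lpConv_mul (q := p.conjExponent) hp hη
      (hT.memLp hφ (ENNReal.HolderConjugate.one_le _ p)), ← integral_const_mul]
  refine integral_congr_ae (ae_of_all _ fun t => ?_)
  simp only
  -- For each `t`, the weak identity of `u` is tested on the translate `φ(· + t)`.
  rw [(h.2 _ (hφ.comp_add_right t)).2]
  simp only [hT.comp_add_right hφ]
  ring

/-- The derivative of a convolution may be put on the smooth factor. -/
theorem HasWeakDual.lpConv_left (hT : IsTranslationOperator T) (hp : p ≠ ⊤) {η K : ℝ → ℝ}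
    (h : HasWeakDual T c η K) (hη : Integrable η volume) (hK : Integrable K volume)
    (f : Lp ℝ p (volume : Measure ℝ)) :
    HasWeakDual T c (_root_.lpConv η f) (_root_.lpConv K f) := by
  refine ⟨Lp.locallyIntegrable_coeFn _, fun φ hφ => ⟨hT.integrable_mul _ hφ, ?_⟩⟩
  have hTφ := hT.memLp hφ (ENNReal.HolderConjugate.one_le p.conjExponent p)
  rw [integral_lpConv_mul (q := p.conjExponent) hp hK (hφ.memLp _),
    integral_lpConv_mul (q := p.conjExponent) hp hη hTφ,
    integral_mul_integral_translate hK (Lp.memLp f) (hφ.memLp p.conjExponent),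
    integral_mul_integral_translate hη (Lp.memLp f) hTφ, ← integral_const_mul]
  refine integral_congr_ae (ae_of_all _ fun x => ?_)
  -- After the exchange of integrals `x` is the frozen variable, and the identity of `η` is tested
  -- on `φ(· + x)`.
  have := (h.2 _ (hφ.comp_add_right x)).2
  simp only [hT.comp_add_right hφ] at this
  simp only [add_comm x, this]
  ring

/-- Weak derivatives are closed under limits in `L^p`. -/
theorem HasWeakDual.of_tendsto (hT : IsTranslationOperator T) {ι : Type*} {l : Filter ι} [l.NeBot]
    {u v : ι → Lp ℝ p (volume : Measure ℝ)} {u₀ v₀ : Lp ℝ p (volume : Measure ℝ)}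
    (hu : Filter.Tendsto u l (nhds u₀)) (hv : Filter.Tendsto v l (nhds v₀))
    (h : ∀ i, HasWeakDual T c (u i) (v i)) : HasWeakDual T c u₀ v₀ := by
  refine ⟨Lp.locallyIntegrable_coeFn _, fun φ hφ => ⟨hT.integrable_mul _ hφ, ?_⟩⟩
  obtain ⟨Λ, hΛ⟩ := exists_pairing (p := p) (hφ.memLp p.conjExponent)
  obtain ⟨M, hM⟩ := exists_pairing (p := p)
    (hT.memLp hφ (ENNReal.HolderConjugate.one_le p.conjExponent p))
  rw [← hΛ, ← hM]
  refine tendsto_nhds_unique ((Λ.continuous.tendsto _).comp hv) ?_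
  refine (((M.continuous.tendsto _).comp hu).const_mul c).congr fun i => ?_
  simp only [Function.comp_apply, hΛ, hM]
  exact ((h i).2 φ hφ).2.symm

/-- The convolution of a test function and a compactly supported function is a test function. -/
theorem exists_isTestFunction_lpConv (hp : p ≠ ⊤) {η g : ℝ → ℝ} (hη : IsTestFunction η)
    (hg : MemLp g p volume) (hgc : HasCompactSupport g) :
    ∃ φ, IsTestFunction φ ∧ lpConv η (hg.toLp g) =ᵐ[volume] φ := by
  have hgl : LocallyIntegrable g volume := hg.locallyIntegrable Fact.out
  have hηi : Integrable η volume := memLp_one_iff_integrable.1 (hη.memLp 1)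
  refine ⟨η ⋆[ContinuousLinearMap.mul ℝ ℝ, volume] g,
    ⟨hη.2.contDiff_convolution_left _ (n := ⊤) hη.1 hgl, hη.2.convolution _ hgc⟩, ?_⟩
  refine ae_eq_of_integral_contDiff_smul_eq (Lp.locallyIntegrable_coeFn _)
    (hη.2.contDiff_convolution_left _ (n := ⊤) hη.1 hgl).continuous.locallyIntegrable
    fun φ hφ hφc => ?_
  have hφ' : IsTestFunction φ := ⟨hφ, hφc⟩
  have h1 := integral_lpConv_mul (q := p.conjExponent) hp hηi (hφ'.memLp _) (hg.toLp g)
  have h2 := integral_convolution_mul (q := p.conjExponent) hηi hg (hφ'.memLp _)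
  rw [← integral_mul_integral_translate (q := p.conjExponent) hηi hg (hφ'.memLp _)] at h2
  simp only [smul_eq_mul, mul_comm (φ _), convolution_def, ContinuousLinearMap.mul_apply']
  rw [h1, h2]
  refine integral_congr_ae (ae_of_all _ fun t => ?_)
  simp only
  congr 1
  refine integral_congr_ae ?_
  filter_upwards [hg.coeFn_toLp] with x hx
  rw [hx]

/-! ### Approximate identities -/

/-- A sequence of mollifiers. -/
noncomputable def mollifierBump (j : ℕ) : ContDiffBump (0 : ℝ) where
  rIn := 1 / ((j : ℝ) + 1) / 2
  rOut := 1 / ((j : ℝ) + 1)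
  rIn_pos := by positivity
  rIn_lt_rOut := by
    have : 0 < 1 / ((j : ℝ) + 1) := by positivity
    linarith

/-- The smooth function of integral `1` supported in `[-1/(j+1), 1/(j+1)]`. -/
noncomputable def mollifier (j : ℕ) : ℝ → ℝ := (mollifierBump j).normed volume

theorem isTestFunction_mollifier (j : ℕ) : IsTestFunction (mollifier j) :=
  ⟨(mollifierBump j).contDiff_normed, (mollifierBump j).hasCompactSupport_normed⟩

theorem IsTestFunction.integrable {φ : ℝ → ℝ} (h : IsTestFunction φ) : Integrable φ volume :=
  memLp_one_iff_integrable.1 (h.memLp 1)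

/-- The error is an average of `lpTranslate t f - f` over `|t| < 1/(j+1)`, small by continuity of
translation. -/
theorem tendsto_lpConv_mollifier (hp : p ≠ ⊤) (f : Lp ℝ p (volume : Measure ℝ)) :
    Filter.Tendsto (fun j => lpConv (mollifier j) f) Filter.atTop (nhds f) := by
  rw [Metric.tendsto_atTop]
  intro ε hε
  have hc : Filter.Tendsto (fun t => lpTranslate t f) (nhds 0) (nhds f) := by
    simpa [lpTranslate_zero] using (continuous_lpTranslate hp f).tendsto 0
  obtain ⟨δ, hδ, hball⟩ := Metric.tendsto_nhds_nhds.1 hc (ε / 2) (half_pos hε)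
  obtain ⟨N, hN⟩ := exists_nat_one_div_lt hδ
  refine ⟨N, fun j hj => ?_⟩
  have hηi := (isTestFunction_mollifier j).integrable
  have h1 : ∫ t, mollifier j t = 1 := (mollifierBump j).integral_normed
  have h0 : ∀ t, 0 ≤ mollifier j t := (mollifierBump j).nonneg_normed
  have e : lpConv (mollifier j) f - f =
      ∫ t, mollifier j t • (lpTranslate t f - f) := by
    simp only [smul_sub]
    rw [integral_sub (integrable_smul_lpTranslate hp hηi f) (hηi.smul_const f),
      integral_smul_const, h1, one_smul, lpConv]
  rw [dist_eq_norm, e]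
  refine lt_of_le_of_lt ?_ (half_lt_self hε)
  calc ‖∫ t, mollifier j t • (lpTranslate t f - f)‖
      ≤ ∫ t, mollifier j t * (ε / 2) := by
        refine norm_integral_le_of_norm_le (hηi.mul_const _) (ae_of_all _ fun t => ?_)
        rw [norm_smul, Real.norm_of_nonneg (h0 t)]
        by_cases ht : mollifier j t = 0
        · simp [ht]
        refine mul_le_mul_of_nonneg_left ?_ (h0 t)
        rw [← dist_eq_norm]
        refine (hball ?_).le
        have hs : t ∈ Function.support ((mollifierBump j).normed volume) := ht
        rw [ContDiffBump.support_normed_eq, Metric.mem_ball] at hs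
        refine hs.trans (lt_of_le_of_lt ?_ hN)
        exact one_div_le_one_div_of_le (by positivity) (by exact_mod_cast Nat.succ_le_succ hj)
    _ = ε / 2 := by rw [integral_mul_const, h1, one_mul]

end LpConv

/-! ### The completion of a dense subspace -/

/-- The extension of `j` is an isometry from a complete space, so its range is closed; it is also
dense. -/
theorem LinearIsometry.exists_completion_equiv {V E : Type*} [NormedAddCommGroup V]
    [NormedSpace ℝ V] [NormedAddCommGroup E] [NormedSpace ℝ E] [CompleteSpace E]
    (j : V →ₗᵢ[ℝ] E) (hj : DenseRange j) :
    ∃ Φ : UniformSpace.Completion V ≃ₗᵢ[ℝ] E,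
      ∀ v : V, Φ (v : UniformSpace.Completion V) = j v := by
  have hiso : Isometry (UniformSpace.Completion.extension j) := j.isometry.completion_extension
  have hcoe : ∀ v : V, UniformSpace.Completion.extension j v = j v := fun v =>
    UniformSpace.Completion.extension_coe j.isometry.uniformContinuous v
  have hc := hiso.continuous
  have hsmul : ∀ (r : ℝ) a, UniformSpace.Completion.extension j (r • a) =
      r • UniformSpace.Completion.extension j a := fun r a => by
    refine UniformSpace.Completion.induction_on a (isClosed_eq
      (hc.comp (continuous_const_smul r)) (hc.const_smul r)) fun a => ?_
    rw [← UniformSpace.Completion.coe_smul, hcoe, hcoe, map_smul]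
  let F : UniformSpace.Completion V →ₗᵢ[ℝ] E :=
    { toFun := UniformSpace.Completion.extension j
      map_add' := fun a b => by
        refine UniformSpace.Completion.induction_on₂ a b (isClosed_eq
          (hc.comp continuous_add)
          ((hc.comp continuous_fst).add (hc.comp continuous_snd))) fun a b => ?_
        rw [← UniformSpace.Completion.coe_add, hcoe, hcoe, hcoe, map_add]
      map_smul' := hsmul
      norm_map' := fun a => by
        have h := hiso.dist_eq a 0
        have h0 : UniformSpace.Completion.extension j 0 = 0 := by
          simpa using hsmul 0 0
        rw [h0, dist_zero_right, dist_zero_right] at h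
        exact h }
  have hsurj : Function.Surjective F := by
    have hcl : IsClosed (range F) := F.isometry.isClosedEmbedding.isClosed_range
    have hsub : range j ⊆ range F := by
      rintro _ ⟨v, rfl⟩
      exact ⟨(v : UniformSpace.Completion V), hcoe v⟩
    exact range_eq_univ.1 (hcl.closure_eq ▸ (hj.mono hsub).closure_eq)
  exact ⟨LinearIsometryEquiv.ofSurjective F hsurj, hcoe⟩

theorem completionEquals_of_dense {E : Type*} [NormedAddCommGroup E] [NormedSpace ℝ E]
    [CompleteSpace E] (V : Submodule ℝ E) (hV : Dense (V : Set E)) : CompletionEquals V :=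
  V.subtypeₗᵢ.exists_completion_equiv (by simpa [DenseRange] using hV)

/-! ### The fractional Sobolev space -/

namespace FracSobolev

variable {s : Side} {α : ℝ} {p : ℝ≥0}

/-- An element of `^±W^{α,p}(ℝ)` from its weak derivatives. -/
noncomputable def ofDerivs (u : Lp ℝ (p : ℝ≥0∞) (volume : Measure ℝ))
    (w : Fin (⌊α⌋₊ + 1) → Lp ℝ (p : ℝ≥0∞) (volume : Measure ℝ))
    (v : Lp ℝ (p : ℝ≥0∞) (volume : Measure ℝ))
    (hw : ∀ k : Fin (⌊α⌋₊ + 1), HasWeakDeriv k u (w k)) (hv : HasWeakFracDeriv s α u v) :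
    FracSobolev s α p :=
  ⟨u, fun k => ⟨w k, hw k⟩, v, hv⟩

theorem weakDeriv_eq {u : FracSobolev s α p} {k : Fin (⌊α⌋₊ + 1)}
    {w : Lp ℝ (p : ℝ≥0∞) (volume : Measure ℝ)} (h : HasWeakDeriv k (toLp u) w) :
    weakDeriv u k = w :=
  Lp.ext (HasWeakDual.unique (weakDeriv_spec u k) h)

theorem fracDeriv_eq {u : FracSobolev s α p} {v : Lp ℝ (p : ℝ≥0∞) (volume : Measure ℝ)}
    (h : HasWeakFracDeriv s α (toLp u) v) : fracDeriv u = v :=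
  Lp.ext (HasWeakDual.unique (fracDeriv_spec u) h)

theorem testFunctions_subset_smoothFunctions :
    testFunctions s α p ⊆ (smoothFunctions s α p : Set (FracSobolev s α p)) :=
  fun _ ⟨φ, hφ, hu⟩ => ⟨φ, hφ.1, hu⟩

theorem testFunctions_subset_oneSidedFunctions :
    testFunctions s α p ⊆ (oneSidedFunctions s α p : Set (FracSobolev s α p)) := by
  rintro _ ⟨φ, hφ, hu⟩
  obtain ⟨R, -, hR⟩ := hφ.2.exists_forall_lt_abs
  refine ⟨φ, hφ.1, ?_, hu⟩
  cases s with
  | left => exact ⟨R, fun x hx => hR x (lt_abs.2 (Or.inl hx))⟩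
  | right => exact ⟨-R, fun x hx => hR x (lt_abs.2 (Or.inr (by linarith)))⟩

variable [Fact (1 ≤ (p : ℝ≥0∞))]

/-! ### Completeness of the space -/

theorem isometry_jet : Isometry (jet : FracSobolev s α p → _) :=
  AddMonoidHomClass.isometry_of_norm (jet : FracSobolev s α p →ₗ[ℝ] _)
    fun u => (norm_eq_norm_jet u).symm

/-- Convergence in `^±W^{α,p}(ℝ)` is convergence of all the derivatives in `L^p(ℝ)`. -/
theorem tendsto_of_derivs {ι : Type*} {l : Filter ι} {u : ι → FracSobolev s α p}
    {u₀ : FracSobolev s α p}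
    (hw : ∀ k, Filter.Tendsto (fun i => weakDeriv (u i) k) l (nhds (weakDeriv u₀ k)))
    (hv : Filter.Tendsto (fun i => fracDeriv (u i)) l (nhds (fracDeriv u₀))) :
    Filter.Tendsto u l (nhds u₀) := by
  rw [isometry_jet.isEmbedding.tendsto_nhds_iff]
  refine ((WithLp.prod_continuous_toLp (p : ℝ≥0∞) _ _).tendsto _).comp
    (Filter.Tendsto.prodMk_nhds ?_ hv)
  exact ((PiLp.continuous_toLp (p : ℝ≥0∞) _).tendsto _).comp (tendsto_pi_nhds.2 hw)

/-- `jet` embeds the space isometrically in a finite product of copies of `L^p`; its range is closed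
because weak derivatives pass to `L^p` limits. -/
theorem complete (hα : 0 ≤ α) : CompleteSpace (FracSobolev s α p) := by
  rw [completeSpace_iff_isComplete_range isometry_jet.isUniformInducing]
  refine IsClosed.isComplete (isClosed_of_closure_subset fun z hz => ?_)
  obtain ⟨x, hx, hxz⟩ := mem_closure_iff_seq_limit.1 hz
  choose u hu using hx
  have hz1 := ((WithLp.prod_continuous_ofLp (p : ℝ≥0∞) _ _).tendsto z).comp hxz
  have hz2 : Filter.Tendsto (fun i => fracDeriv (u i)) Filter.atTop (nhds z.snd) := by
    refine ((continuous_snd.tendsto _).comp hz1).congr fun i => ?_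
    rw [Function.comp_apply, Function.comp_apply, ← hu i]; rfl
  have hz3 : ∀ k, Filter.Tendsto (fun i => weakDeriv (u i) k) Filter.atTop
      (nhds (z.fst k)) := by
    intro k
    have h := ((PiLp.continuous_ofLp (p : ℝ≥0∞) _).tendsto _).comp
      ((continuous_fst.tendsto _).comp hz1)
    refine ((tendsto_pi_nhds.1 h) k).congr fun i => ?_
    simp only [Function.comp_apply]
    rw [← hu i]; rfl
  -- The zeroth weak derivative is the function itself, so component `0` of the limit jet is the
  -- candidate limit.
  have hu0 : Filter.Tendsto (fun i => toLp (u i)) Filter.atTop (nhds (z.fst 0)) :=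
    (hz3 0).congr fun i => (toLp_eq_weakDeriv_zero (u i) Fact.out).symm
  have hw : ∀ k : Fin (⌊α⌋₊ + 1), HasWeakDeriv k (z.fst 0) (z.fst k) := fun k =>
    HasWeakDual.of_tendsto (isTranslationOperator_iteratedDeriv k) hu0 (hz3 k)
      fun i => weakDeriv_spec (u i) k
  have hv : HasWeakFracDeriv s α (z.fst 0) z.snd :=
    HasWeakDual.of_tendsto (isTranslationOperator_rlDeriv _ hα) hu0 hz2
      fun i => fracDeriv_spec (u i)
  refine ⟨ofDerivs _ _ _ hw hv, ?_⟩
  refine tendsto_nhds_unique ?_ hxz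
  have := (isometry_jet.continuous.tendsto (ofDerivs _ _ _ hw hv)).comp
    (tendsto_of_derivs (u := u) (l := Filter.atTop) (u₀ := ofDerivs _ _ _ hw hv) ?_ ?_)
  · exact this.congr hu
  · intro k
    rw [weakDeriv_eq (u := ofDerivs _ _ _ hw hv) (hw k)]
    exact hz3 k
  · rw [fracDeriv_eq (u := ofDerivs _ _ _ hw hv) hv]
    exact hz2

/-! ### Density of the test functions -/

theorem exists_represents (s : Side) (hα : 0 ≤ α) {φ : ℝ → ℝ} (hφ : IsTestFunction φ) :
    ∃ u : FracSobolev s α p, Represents φ u := by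
  have h1 : (1 : ℝ≥0∞) ≤ p := Fact.out
  have hm := (rlDeriv_memLp s hα hφ h1).const_smul ((-1 : ℝ) ^ ⌊α⌋₊)
  exact ⟨ofDerivs ((hφ.memLp p).toLp φ) (fun k => ((hφ.iteratedDeriv k).memLp p).toLp _) (hm.toLp _)
    (fun k => (hφ.hasWeakDeriv k).congr (MemLp.coeFn_toLp _) (MemLp.coeFn_toLp _))
    (HasWeakDual.congr (hφ.hasWeakFracDeriv s hα) (MemLp.coeFn_toLp _) (MemLp.coeFn_toLp _)),
    (hφ.memLp p).coeFn_toLp⟩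

/-- The convolution of `f ∈ L^p(ℝ)` with a test function, as an element of
`^±W^{α,p}(ℝ)`. -/
noncomputable def mollify (s : Side) (hα : 0 ≤ α) {η : ℝ → ℝ} (hη : IsTestFunction η)
    (f : Lp ℝ (p : ℝ≥0∞) (volume : Measure ℝ)) : FracSobolev s α p :=
  ofDerivs (lpConv η f) (fun k => lpConv (iteratedDeriv k η) f)
    (lpConv ((-1 : ℝ) ^ ⌊α⌋₊ • rlDeriv s α η) f)
    (fun k => HasWeakDual.lpConv_left (isTranslationOperator_iteratedDeriv k) ENNReal.coe_ne_top
      (hη.hasWeakDeriv k) hη.integrable (hη.iteratedDeriv k).integrable f)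
    (HasWeakDual.lpConv_left (isTranslationOperator_rlDeriv _ hα) ENNReal.coe_ne_top
      (hη.hasWeakFracDeriv s hα) hη.integrable
      ((rlDeriv_integrable_and_bounded s hα hη).1.smul _) f)

theorem weakDeriv_mollify (hα : 0 ≤ α) {η : ℝ → ℝ} (hη : IsTestFunction η)
    (f : Lp ℝ (p : ℝ≥0∞) (volume : Measure ℝ)) (k : Fin (⌊α⌋₊ + 1)) :
    weakDeriv (mollify s hα hη f) k = lpConv (iteratedDeriv k η) f :=
  weakDeriv_eq (HasWeakDual.lpConv_left (isTranslationOperator_iteratedDeriv k)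
    ENNReal.coe_ne_top (hη.hasWeakDeriv k) hη.integrable (hη.iteratedDeriv k).integrable f)

theorem fracDeriv_mollify (hα : 0 ≤ α) {η : ℝ → ℝ} (hη : IsTestFunction η)
    (f : Lp ℝ (p : ℝ≥0∞) (volume : Measure ℝ)) :
    fracDeriv (mollify s hα hη f) = lpConv ((-1 : ℝ) ^ ⌊α⌋₊ • rlDeriv s α η) f :=
  fracDeriv_eq (HasWeakDual.lpConv_left (isTranslationOperator_rlDeriv _ hα) ENNReal.coe_ne_top
    (hη.hasWeakFracDeriv s hα) hη.integrable
    ((rlDeriv_integrable_and_bounded s hα hη).1.smul _) f)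

/-- All derivatives fall on `η`, and convolution with a fixed `L^1` function is bounded on `L^p`; so
the `L^p` norm on the source is enough. -/
theorem continuous_mollify (hα : 0 ≤ α) {η : ℝ → ℝ} (hη : IsTestFunction η) :
    Continuous (mollify (p := p) s hα hη) := by
  refine continuous_iff_continuousAt.2 fun f => tendsto_of_derivs (fun k => ?_) ?_
  · simp only [weakDeriv_mollify]
    exact (continuous_lpConv ENNReal.coe_ne_top (hη.iteratedDeriv k).integrable).tendsto f
  · simp only [fracDeriv_mollify]
    exact (continuous_lpConv ENNReal.coe_ne_top
      ((rlDeriv_integrable_and_bounded s hα hη).1.smul _)).tendsto f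

/-- Here the derivatives fall on `u`: each equals `η_j * Du`, which tends to `Du`. -/
theorem tendsto_mollify (hα : 0 ≤ α) (u : FracSobolev s α p) :
    Filter.Tendsto (fun j => mollify s hα (isTestFunction_mollifier j) (toLp u)) Filter.atTop
      (nhds u) := by
  have hp : (p : ℝ≥0∞) ≠ ⊤ := ENNReal.coe_ne_top
  refine tendsto_of_derivs (fun k => ?_) ?_
  · refine (tendsto_lpConv_mollifier hp (weakDeriv u k)).congr fun j => ?_
    exact (weakDeriv_eq (u := mollify s hα (isTestFunction_mollifier j) (toLp u))
      (HasWeakDual.lpConv (isTranslationOperator_iteratedDeriv k) hp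
      (weakDeriv_spec u k) (isTestFunction_mollifier j).integrable)).symm
  · refine (tendsto_lpConv_mollifier hp (fracDeriv u)).congr fun j => ?_
    exact (fracDeriv_eq (u := mollify s hα (isTestFunction_mollifier j) (toLp u))
      (HasWeakDual.lpConv (isTranslationOperator_rlDeriv _ hα) hp
      (fracDeriv_spec u) (isTestFunction_mollifier j).integrable)).symm

/-- Compactly supported functions are dense in `L^p`, and continuous `mollify` sends them to test
functions. -/
theorem mollify_mem_closure (hα : 0 ≤ α) {η : ℝ → ℝ} (hη : IsTestFunction η)
    (f : Lp ℝ (p : ℝ≥0∞) (volume : Measure ℝ)) :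
    mollify s hα hη f ∈ closure (testFunctions s α p) := by
  have hp : (p : ℝ≥0∞) ≠ ⊤ := ENNReal.coe_ne_top
  have hf : f ∈ closure {g : Lp ℝ (p : ℝ≥0∞) (volume : Measure ℝ) |
      ∃ (h : ℝ → ℝ) (hm : MemLp h p volume), HasCompactSupport h ∧ g = hm.toLp h} := by
    rw [EMetric.mem_closure_iff]
    intro ε hε
    obtain ⟨δ, hδ0, hδ⟩ := exists_between hε
    obtain ⟨g, hgc, hfg, -, hg⟩ :=
      (Lp.memLp f).exists_hasCompactSupport_eLpNorm_sub_le hp hδ0.ne'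
    refine ⟨hg.toLp g, ⟨g, hg, hgc, rfl⟩, lt_of_le_of_lt ?_ hδ⟩
    rw [Lp.edist_def]
    refine (eLpNorm_congr_ae ?_).trans_le hfg
    filter_upwards [hg.coeFn_toLp] with x hx
    simp [hx]
  refine map_mem_closure (continuous_mollify hα hη) hf ?_
  rintro _ ⟨g, hg, hgc, rfl⟩
  exact exists_isTestFunction_lpConv hp hη hg hgc

theorem dense_testFunctions (hα : 0 ≤ α) : Dense (testFunctions s α p) := fun u =>
  isClosed_closure.mem_of_tendsto (tendsto_mollify hα u)
    (Filter.Eventually.of_forall fun j => mollify_mem_closure hα (isTestFunction_mollifier j) _)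

end FracSobolev

theorem mainTheorem2 (s : Side) (α : ℝ) (hα : 0 < α) (p : ℝ≥0) [Fact (1 ≤ (p : ℝ≥0∞))] :
    (∀ φ : ℝ → ℝ, IsTestFunction φ → ∃ u : FracSobolev s α p, FracSobolev.Represents φ u) ∧
    Dense (FracSobolev.testFunctions s α p) ∧
    CompletionEquals (FracSobolev.smoothFunctions s α p) ∧
    CompletionEquals (FracSobolev.oneSidedFunctions s α p) := by
  have hd := FracSobolev.dense_testFunctions (s := s) (p := p) hα.le
  have : CompleteSpace (FracSobolev s α p) := FracSobolev.complete hα.le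
  exact ⟨fun φ hφ => FracSobolev.exists_represents s hα.le hφ, hd,
    completionEquals_of_dense _ (hd.mono FracSobolev.testFunctions_subset_smoothFunctions),
    completionEquals_of_dense _ (hd.mono FracSobolev.testFunctions_subset_oneSidedFunctions)⟩
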